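/- Let $W$ denote the principal branch of the Lambert function, i.e. the inverse of $w\mapsto we^w$ ($W(z)e^{W(z)}=z$) that is holomorphic on $\mathbb{C}\setminus(-\infty,-1/e]$ and maps the positive real axis to itself. For $\xi>0$ put $$\varphi(\xi)=\frac1\pi\int_0^\pi \exp\!\left(-\xi\, v\csc(v)\,e^{-v\cot v}\right)dv .$$ Then the integral defining $\varphi(\xi)$ converges, $\varphi(\xi)>0$, and for every complex $z$ with $\operatorname{Re} z\ge 0$ $$W(z)=\int_0^\infty\frac{1-e^{-z\xi}}{\xi}\,\varphi(\xi)\,d\xi ,$$ the integral being absolutely convergent. Moreover this is a Lévy–Khintchine representation of $W$ (with zero constant and linear terms): the measure $d\nu(\xi)=\frac{\varphi(\xi)}{\xi}\,d\xi$ on $(0,\infty)$ is a Lévy measure, that is $\int_0^\infty \frac{\xi}{1+\xi}\,d\nu(\xi)<\infty$, and $$W(z)=\int_0^\infty\left(1-e^{-z\xi}\right)d\nu(\xi)\qquad(\operatorname{Re} z\ge 0),$$ where this integral too is absolutely convergent. -/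

import Mathlib

open MeasureTheory Set

namespace Lambert

/-- The branch cut `(-∞, -1/e]` of the principal branch, as a subset of `ℂ`. -/
def branchCut : Set ℂ := (fun t : ℝ => (t : ℂ)) '' Iic (-(Real.exp 1)⁻¹)

/-- `W` is the principal branch of the Lambert function: it inverts `w ↦ w * exp w`, is holomorphic
off the cut `(-∞, -1/e]`, and maps the positive real axis to itself. On the cut the value is the one
with imaginary part in `(0, π)`, and it is real at the branch point. -/
structure IsPrincipalBranch (W : ℂ → ℂ) : Prop where
  mul_exp : ∀ z : ℂ, W z * Complex.exp (W z) = z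
  holomorphic : DifferentiableOn ℂ W branchCutᶜ
  pos : ∀ x : ℝ, 0 < x → 0 < (W x).re ∧ (W x).im = 0
  cut : ∀ t : ℝ, t < -(Real.exp 1)⁻¹ → (W t).im ∈ Ioo 0 Real.pi
  branch_point : (W ((-(Real.exp 1)⁻¹ : ℝ) : ℂ)).im = 0

open Classical in
/-- The principal branch `W = W₀` of the Lambert function. -/
noncomputable def lambertW : ℂ → ℂ :=
  if h : ∃ W : ℂ → ℂ, IsPrincipalBranch W then h.choose else 0

theorem branchCut_compl_eq :
    branchCutᶜ = (fun z : ℂ => z + ((Real.exp 1)⁻¹ : ℝ)) ⁻¹' Complex.slitPlane := by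
  ext z
  simp only [branchCut, mem_compl_iff, mem_image, mem_Iic, mem_preimage,
    Complex.mem_slitPlane_iff, Complex.add_re, Complex.add_im, Complex.ofReal_re,
    Complex.ofReal_im, add_zero]
  constructor
  · intro h
    by_contra hc
    push Not at hc
    exact h ⟨z.re, by linarith [hc.1], Complex.ext (by simp) (by simp [hc.2])⟩
  · rintro h ⟨t, ht, rfl⟩
    rcases h with h | h
    · simp only [Complex.ofReal_re] at h
      linarith
    · simp at h

/-- Off the branch cut the principal branch is unique, so the choice in `lambertW` is immaterial. -/
theorem IsPrincipalBranch.eqOn {V W : ℂ → ℂ} (hV : IsPrincipalBranch V)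
    (hW : IsPrincipalBranch W) : EqOn V W branchCutᶜ := by
  have hopen : IsOpen branchCutᶜ := by
    rw [branchCut_compl_eq]
    exact Complex.isOpen_slitPlane.preimage (by fun_prop)
  have hconn : IsPreconnected branchCutᶜ := by
    have h : branchCutᶜ = (fun z : ℂ => z - ((Real.exp 1)⁻¹ : ℝ)) '' Complex.slitPlane := by
      rw [branchCut_compl_eq]
      ext z
      constructor
      · intro hz
        exact ⟨_, hz, by simp⟩
      · rintro ⟨w, hw, rfl⟩
        simpa using hw
    rw [h]
    exact (Complex.starConvex_one_slitPlane.isPathConnected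
      Complex.one_mem_slitPlane).isConnected.isPreconnected.image _
        (by fun_prop)
  have hpos : ∀ x : ℝ, 0 < x → V x = W x := by
    intro x hx
    have key : ∀ U : ℂ → ℂ, IsPrincipalBranch U → (U x).re * Real.exp (U x).re = x := by
      intro U hU
      have h1 : U x = ((U x).re : ℂ) := Complex.ext (by simp) (by simp [(hU.pos x hx).2])
      have h2 := hU.mul_exp x
      rw [h1] at h2
      exact_mod_cast h2
    have hv := key V hV
    have hw := key W hW
    have hv0 := (hV.pos x hx).1
    have hw0 := (hW.pos x hx).1
    refine Complex.ext ?_ (by rw [(hV.pos x hx).2, (hW.pos x hx).2])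
    rcases lt_trichotomy (V x).re (W x).re with h | h | h
    · have := mul_lt_mul'' h (Real.exp_lt_exp.2 h) hv0.le (Real.exp_pos _).le
      linarith
    · exact h
    · have := mul_lt_mul'' h (Real.exp_lt_exp.2 h) hw0.le (Real.exp_pos _).le
      linarith
  have h1 : (1 : ℂ) ∈ branchCutᶜ := by
    rw [branchCut_compl_eq]
    left
    simp only [Complex.add_re, Complex.one_re, Complex.ofReal_re]
    positivity
  refine (hV.holomorphic.analyticOnNhd hopen).eqOn_of_preconnected_of_frequently_eq
    (hW.holomorphic.analyticOnNhd hopen) hconn h1 ?_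
  have ht : Filter.Tendsto (fun x : ℝ => (x : ℂ)) (nhdsWithin 1 (Ioi 1)) (nhdsWithin 1 {1}ᶜ) := by
    refine tendsto_nhdsWithin_iff.2 ⟨?_, ?_⟩
    · have : Filter.Tendsto (fun x : ℝ => (x : ℂ)) (nhds 1) (nhds ((1 : ℝ) : ℂ)) :=
        Complex.continuous_ofReal.tendsto 1
      rw [Complex.ofReal_one] at this
      exact this.mono_left nhdsWithin_le_nhds
    · filter_upwards [self_mem_nhdsWithin] with x hx
      simpa using (ne_of_gt hx : x ≠ 1)
  refine ht.frequently (Filter.Eventually.frequently ?_)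
  filter_upwards [self_mem_nhdsWithin] with x hx
  exact hpos x (lt_trans one_pos hx)

/-- The integrand `exp (-ξ v csc v e^{-v cot v})` of `phi`. -/
noncomputable def phiIntegrand (ξ v : ℝ) : ℝ :=
  Real.exp (-ξ * (v * (1 / Real.sin v) * Real.exp (-v * Real.cot v)))

/-- `φ(ξ) = (1/π) ∫₀^π exp (-ξ v csc v e^{-v cot v}) dv`. -/
noncomputable def phi (ξ : ℝ) : ℝ :=
  (1 / Real.pi) * ∫ v in (0 : ℝ)..Real.pi, phiIntegrand ξ v

/-- A Lévy measure on `(0, ∞)` (as a measure on `ℝ` carried by `(0, ∞)`), in the sense of the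
Lévy–Khintchine representation of Bernstein functions: `∫ ξ / (1 + ξ) dν(ξ) < ∞`. -/
def IsLevyMeasure (ν : Measure ℝ) : Prop :=
  ν (Iic 0) = 0 ∧ ∫⁻ ξ, ENNReal.ofReal (ξ / (1 + ξ)) ∂ν < ⊤

/-- The measure `dν = (φ(ξ) / ξ) dξ` on `(0, ∞)`. -/
noncomputable def levyMeasure : Measure ℝ :=
  (volume.restrict (Ioi 0)).withDensity fun ξ => ENNReal.ofReal (phi ξ / ξ)

end Lambert

/-! Write b(v) = v csc v e^{-v cot v} on (0, π), so that b ≥ 1/e and φ(ξ) = (1/π)∫ e^{-ξ b(v)} dv.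
By Fubini and the Frullani-type formula `integral_one_sub_exp_div_mul_exp`, the right-hand side is
L(z) = (1/π)∫ log(1 + z/b(v)) dv (`logIntegral`), and the task is to show L = W.

The moments of 1/b are explicit: (1/π)∫ b^{-n} dv = n^n/n! (`integral_cutModulus_inv_pow`). They
come from integrating the entire function exp(n(e^s - s)) along a curve on which e^s - s is real.
Expanding the logarithm turns L, near 0 on the positive axis, into the Lambert series, whose sum at
w e^w is w (`hasSum_lambert_series`). Hence L e^L = z near 0 on the positive axis, and on the whole
cut plane by the identity theorem (`logIntegral_mul_exp`). Since L is positive on the positive axis,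
it is the principal branch off the cut; -b(v) sweeps out the cut itself, which supplies the values
there and the existence of W. -/

namespace Lambert

open Filter Topology

/-! ### Bounds for `cutModulus`, and exponential decay of φ -/

/-- The function `v csc v e^{-v cot v}`; its negative runs through the branch cut. -/
noncomputable def cutModulus (v : ℝ) : ℝ :=
  v * (1 / Real.sin v) * Real.exp (-v * Real.cot v)

theorem phiIntegrand_eq (ξ v : ℝ) : phiIntegrand ξ v = Real.exp (-ξ * cutModulus v) := rfl

theorem cutModulus_eq (v : ℝ) :
    cutModulus v = v / Real.sin v * Real.exp (-(v * (Real.cos v / Real.sin v))) := by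
  rw [cutModulus, Real.cot_eq_cos_div_sin, neg_mul, mul_one_div]

@[fun_prop]
theorem measurable_cutModulus : Measurable cutModulus := by
  have h : cutModulus =
      fun v => v / Real.sin v * Real.exp (-(v * (Real.cos v / Real.sin v))) :=
    funext cutModulus_eq
  rw [h]
  fun_prop

theorem mul_cos_le_sin {v : ℝ} (hv : v ∈ Ioo 0 Real.pi) : v * Real.cos v ≤ Real.sin v := by
  rcases lt_or_ge v (Real.pi / 2) with h | h
  · have hc : 0 < Real.cos v := Real.cos_pos_of_mem_Ioo ⟨by linarith [hv.1, Real.pi_pos], h⟩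
    have := Real.lt_tan hv.1 h
    rw [Real.tan_eq_sin_div_cos, lt_div_iff₀ hc] at this
    exact this.le
  · have hc : Real.cos v ≤ 0 := Real.cos_nonpos_of_pi_div_two_le_of_le h (by linarith [hv.2])
    exact (mul_nonpos_of_nonneg_of_nonpos hv.1.le hc).trans
      (Real.sin_pos_of_pos_of_lt_pi hv.1 hv.2).le

theorem one_le_div_sin {v : ℝ} (hv : v ∈ Ioo 0 Real.pi) : 1 ≤ v / Real.sin v := by
  rw [one_le_div (Real.sin_pos_of_pos_of_lt_pi hv.1 hv.2)]
  exact Real.sin_le hv.1.le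

/-- Follows from v cot v ≤ 1 and v / sin v ≥ 1. This one bound puts -`cutModulus v` on the branch
cut and makes φ decay like e^{-ξ/e}. -/
theorem inv_exp_one_le_cutModulus {v : ℝ} (hv : v ∈ Ioo 0 Real.pi) :
    (Real.exp 1)⁻¹ ≤ cutModulus v := by
  have hs := Real.sin_pos_of_pos_of_lt_pi hv.1 hv.2
  have h1 : v * (Real.cos v / Real.sin v) ≤ 1 := by
    rw [← mul_div_assoc, div_le_one hs]
    exact mul_cos_le_sin hv
  have h2 : (Real.exp 1)⁻¹ ≤ Real.exp (-(v * (Real.cos v / Real.sin v))) := by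
    rw [← Real.exp_neg]
    exact Real.exp_le_exp.2 (by linarith)
  rw [cutModulus_eq]
  exact h2.trans (le_mul_of_one_le_left (Real.exp_pos _).le (one_le_div_sin hv))

theorem cutModulus_pos {v : ℝ} (hv : v ∈ Ioo 0 Real.pi) : 0 < cutModulus v :=
  lt_of_lt_of_le (by positivity) (inv_exp_one_le_cutModulus hv)

theorem continuousOn_cutModulus : ContinuousOn cutModulus (Ioo 0 Real.pi) := by
  have h : ∀ v ∈ Ioo 0 Real.pi, Real.sin v ≠ 0 := fun v hv =>
    (Real.sin_pos_of_pos_of_lt_pi hv.1 hv.2).ne'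
  have he : cutModulus =
      fun v => v / Real.sin v * Real.exp (-(v * (Real.cos v / Real.sin v))) :=
    funext cutModulus_eq
  rw [he]
  fun_prop (disch := assumption)

theorem measurable_phiIntegrand : Measurable (Function.uncurry phiIntegrand) := by
  have h : Function.uncurry phiIntegrand =
      fun p : ℝ × ℝ => Real.exp (-p.1 * cutModulus p.2) := rfl
  rw [h]
  fun_prop

theorem phiIntegrand_le {ξ v : ℝ} (hξ : 0 ≤ ξ) (hv : v ∈ Ioo 0 Real.pi) :
    phiIntegrand ξ v ≤ Real.exp (-(Real.exp 1)⁻¹ * ξ) := by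
  rw [phiIntegrand_eq, Real.exp_le_exp]
  nlinarith [inv_exp_one_le_cutModulus hv]

theorem phiIntegrand_pos (ξ v : ℝ) : 0 < phiIntegrand ξ v := Real.exp_pos _

theorem integrableOn_phiIntegrand {ξ : ℝ} (hξ : 0 ≤ ξ) :
    IntegrableOn (phiIntegrand ξ) (Ioo 0 Real.pi) := by
  refine Measure.integrableOn_of_bounded (M := Real.exp (-(Real.exp 1)⁻¹ * ξ)) (by simp)
    (measurable_phiIntegrand.comp measurable_prodMk_left).aestronglyMeasurable ?_
  filter_upwards [ae_restrict_mem measurableSet_Ioo] with v hv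
  rw [Real.norm_of_nonneg (phiIntegrand_pos ξ v).le]
  exact phiIntegrand_le hξ hv

theorem intervalIntegrable_phiIntegrand {ξ : ℝ} (hξ : 0 ≤ ξ) :
    IntervalIntegrable (phiIntegrand ξ) volume 0 Real.pi :=
  (intervalIntegrable_iff_integrableOn_Ioo_of_le Real.pi_pos.le).2 (integrableOn_phiIntegrand hξ)

theorem phi_eq (ξ : ℝ) : phi ξ = (1 / Real.pi) * ∫ v in Ioo 0 Real.pi, phiIntegrand ξ v := by
  rw [phi, intervalIntegral.integral_of_le Real.pi_pos.le, integral_Ioc_eq_integral_Ioo]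

theorem phi_pos {ξ : ℝ} (hξ : 0 ≤ ξ) : 0 < phi ξ :=
  mul_pos (by positivity) (intervalIntegral.intervalIntegral_pos_of_pos
    (intervalIntegrable_phiIntegrand hξ) (phiIntegrand_pos ξ) Real.pi_pos)

@[fun_prop]
theorem measurable_phi : Measurable phi := by
  have h : phi = fun ξ => (1 / Real.pi) * ∫ v in Ioo 0 Real.pi, phiIntegrand ξ v := funext phi_eq
  rw [h]
  exact (measurable_phiIntegrand.stronglyMeasurable.integral_prod_right'
    (ν := volume.restrict (Ioo 0 Real.pi))).measurable.const_mul _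

theorem phi_le {ξ : ℝ} (hξ : 0 ≤ ξ) : phi ξ ≤ Real.exp (-(Real.exp 1)⁻¹ * ξ) := by
  have h : ∫ v in Ioo 0 Real.pi, phiIntegrand ξ v ≤
      ∫ _ in Ioo 0 Real.pi, Real.exp (-(Real.exp 1)⁻¹ * ξ) := by
    refine setIntegral_mono_on (integrableOn_phiIntegrand hξ) (by simp) measurableSet_Ioo ?_
    exact fun v hv => phiIntegrand_le hξ hv
  rw [phi_eq]
  simp only [setIntegral_const, Real.volume_real_Ioo_of_le Real.pi_pos.le, sub_zero,
    smul_eq_mul] at h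
  calc _ ≤ (1 / Real.pi) * (Real.pi * Real.exp (-(Real.exp 1)⁻¹ * ξ)) := by gcongr
    _ = _ := by field_simp

theorem integrableOn_exp_neg_inv_exp_one :
    IntegrableOn (fun ξ : ℝ => Real.exp (-(Real.exp 1)⁻¹ * ξ)) (Ioi 0) :=
  integrableOn_exp_mul_Ioi (neg_lt_zero.2 (by positivity)) 0

/-! ### Moments of 1/`cutModulus` by a contour integral -/

/-- A primitive of the entire function `s ↦ exp (n * exp s - n * s)`. The term `k = n` of the
series vanishes, as division by zero gives zero. -/
noncomputable def momentPrimitive (n : ℕ) (s : ℂ) : ℂ :=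
  ((n : ℝ) ^ n / n.factorial : ℝ) * s +
    ∑' k : ℕ, ((n : ℝ) ^ k / k.factorial / ((k : ℝ) - n) : ℝ) * Complex.exp (((k : ℝ) - n : ℝ) * s)

/-- Expand exp(n e^s) in powers of e^s and multiply by e^{-ns}. The constant term k = n integrates
to the linear term of `momentPrimitive`, the source of n^n/n!. -/
theorem hasSum_moment (n : ℕ) (s : ℂ) :
    HasSum (fun k : ℕ => ((n : ℝ) ^ k / k.factorial : ℝ) * Complex.exp (((k : ℝ) - n : ℝ) * s))
      (Complex.exp (n * Complex.exp s - n * s)) := by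
  have h := (NormedSpace.expSeries_div_hasSum_exp (n * Complex.exp s)).mul_right
    (Complex.exp (-(n * s)))
  rw [← Complex.exp_eq_exp_ℂ, ← Complex.exp_add, ← sub_eq_add_neg] at h
  refine h.congr_fun fun k => ?_
  have he : Complex.exp (((k : ℝ) - n : ℝ) * s) = Complex.exp s ^ k * Complex.exp (-(n * s)) := by
    rw [← Complex.exp_nat_mul, ← Complex.exp_add]
    congr 1
    push_cast
    ring
  rw [he]
  push_cast
  ring

theorem hasDerivAt_momentPrimitive (n : ℕ) (s : ℂ) :
    HasDerivAt (momentPrimitive n) (Complex.exp (n * Complex.exp s - n * s)) s := by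
  set R := ‖s‖ + 1
  have hsR : s ∈ Metric.ball (0 : ℂ) R := by simp [R]
  have hu : Summable fun k : ℕ => Real.exp (n * R) * ((n * Real.exp R) ^ k / k.factorial) :=
    (Real.summable_pow_div_factorial _).mul_left _
  have hexp : ∀ (k : ℕ) (y : ℂ), y ∈ Metric.ball (0 : ℂ) R →
      ‖((n : ℝ) ^ k / k.factorial : ℝ) * Complex.exp (((k : ℝ) - n : ℝ) * y)‖ ≤
        Real.exp (n * R) * ((n * Real.exp R) ^ k / k.factorial) := by
    intro k y hy
    have hy' : ‖y‖ ≤ R := (mem_ball_zero_iff.1 hy).le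
    have habs := abs_le.1 ((Complex.abs_re_le_norm y).trans hy')
    rw [norm_mul, Complex.norm_exp, Complex.norm_of_nonneg (by positivity), Complex.re_ofReal_mul,
      mul_pow, ← Real.exp_nat_mul]
    calc (n : ℝ) ^ k / k.factorial * Real.exp (((k : ℝ) - n) * y.re)
        ≤ (n : ℝ) ^ k / k.factorial * Real.exp (n * R + k * R) := by
          gcongr
          have h1 : (k : ℝ) * y.re ≤ k * R := by gcongr; exact habs.2
          have h2 : (n : ℝ) * -y.re ≤ n * R := by gcongr; linarith [habs.1]
          linarith
      _ = _ := by rw [Real.exp_add]; ring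
  have hsum : Summable fun k : ℕ => ((n : ℝ) ^ k / k.factorial / ((k : ℝ) - n) : ℝ) *
      Complex.exp (((k : ℝ) - n : ℝ) * s) := by
    -- Dividing by k - n does not increase the norm: it is a nonzero integer, or else k = n and the
    -- quotient is 0.
    refine Summable.of_norm_bounded hu fun k => le_trans ?_ (hexp k s hsR)
    rw [norm_mul, norm_mul]
    gcongr
    rw [Complex.norm_real, Complex.norm_real, norm_div]
    rcases eq_or_ne k n with rfl | hkn
    · simp only [sub_self, norm_zero, div_zero]
      positivity
    · refine div_le_self (norm_nonneg _) ?_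
      have : (1 : ℤ) ≤ |(k : ℤ) - n| := Int.one_le_abs (by omega)
      rw [Real.norm_eq_abs]
      exact_mod_cast this
  have hne : ∀ k : ℕ, k ≠ n → ((k : ℝ) - n) ≠ 0 := fun k hk =>
    sub_ne_zero.2 (by exact_mod_cast hk)
  have hder : ∀ (k : ℕ) (y : ℂ), HasDerivAt (fun y : ℂ =>
      ((n : ℝ) ^ k / k.factorial / ((k : ℝ) - n) : ℝ) * Complex.exp (((k : ℝ) - n : ℝ) * y))
      (if k = n then 0 else ((n : ℝ) ^ k / k.factorial : ℝ) *
        Complex.exp (((k : ℝ) - n : ℝ) * y)) y := by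
    intro k y
    split_ifs with hk
    · subst hk
      simpa using hasDerivAt_const y (0 : ℂ)
    · have h := (((hasDerivAt_id y).const_mul (((k : ℝ) - n : ℝ) : ℂ)).cexp).const_mul
        (((n : ℝ) ^ k / k.factorial / ((k : ℝ) - n) : ℝ) : ℂ)
      refine h.congr_deriv ?_
      have : ((((k : ℝ) - n : ℝ)) : ℂ) ≠ 0 := by exact_mod_cast hne k hk
      rw [Complex.ofReal_div _ ((k : ℝ) - n)]
      simp only [id]
      field_simp
  have hmain := hasDerivAt_tsum_of_isPreconnected hu Metric.isOpen_ball
    (convex_ball (0 : ℂ) R).isPreconnected (fun k y _ => hder k y) (fun k y hy => by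
      split_ifs
      · rw [norm_zero]; positivity
      · exact hexp k y hy) hsR hsum hsR
  have htot : (Complex.exp (n * Complex.exp s - n * s)) =
      (((n : ℝ) ^ n / n.factorial : ℝ) : ℂ) * 1 + ∑' k : ℕ, (if k = n then 0 else
        ((n : ℝ) ^ k / k.factorial : ℝ) * Complex.exp (((k : ℝ) - n : ℝ) * s)) := by
    rw [← (hasSum_moment n s).tsum_eq, (hasSum_moment n s).summable.tsum_eq_add_tsum_ite n]
    simp
  rw [htot]
  exact ((hasDerivAt_id s).const_mul _).add hmain

theorem im_momentPrimitive_ofReal (n : ℕ) (l : ℝ) : (momentPrimitive n l).im = 0 := by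
  have h : momentPrimitive n l = (((n : ℝ) ^ n / n.factorial * l + ∑' k : ℕ,
      (n : ℝ) ^ k / k.factorial / ((k : ℝ) - n) * Real.exp (((k : ℝ) - n) * l) : ℝ) : ℂ) := by
    rw [momentPrimitive]
    push_cast
    rfl
  rw [h, Complex.ofReal_im]

/-- On the line Im s = π each e^{(k-n)s} is real because k - n is an integer, so only the linear
term has an imaginary part. -/
theorem im_momentPrimitive_add_pi (n : ℕ) (l : ℝ) :
    (momentPrimitive n (l + Real.pi * Complex.I)).im = (n : ℝ) ^ n / n.factorial * Real.pi := by
  have h : momentPrimitive n (l + Real.pi * Complex.I) =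
      (((n : ℝ) ^ n / n.factorial * l + ∑' k : ℕ, (n : ℝ) ^ k / k.factorial / ((k : ℝ) - n) *
        (Real.exp (((k : ℝ) - n) * l) * Real.cos (((k : ℝ) - n) * Real.pi)) : ℝ) : ℂ) +
      ((n : ℝ) ^ n / n.factorial * Real.pi : ℝ) * Complex.I := by
    have he : ∀ k : ℕ, Complex.exp (((k : ℝ) - n : ℝ) * (l + Real.pi * Complex.I)) =
        ((Real.exp (((k : ℝ) - n) * l) * Real.cos (((k : ℝ) - n) * Real.pi) : ℝ) : ℂ) := by
      intro k
      have hs : Real.sin (((k : ℝ) - n) * Real.pi) = 0 := by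
        have := Real.sin_int_mul_pi ((k : ℤ) - n)
        push_cast at this
        exact this
      rw [mul_add, Complex.exp_add, ← mul_assoc, ← Complex.ofReal_mul, ← Complex.ofReal_mul,
        Complex.exp_mul_I, ← Complex.ofReal_sin, ← Complex.ofReal_cos, hs]
      push_cast
      ring
    simp only [momentPrimitive, he]
    push_cast
    ring
  rw [h, Complex.add_im, Complex.ofReal_im, Complex.im_ofReal_mul, Complex.I_im]
  ring

/-- The logarithm of the curve `v ↦ v e^{iv} / sin v`. -/
noncomputable def logContour (v : ℝ) : ℂ := (Real.log (v / Real.sin v) : ℝ) + v * Complex.I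

/-- With s = `logContour v` one has e^s = v cot v + iv, so the imaginary parts of e^s and s cancel:
the integrand is real along the curve. -/
theorem exp_moment_logContour (n : ℕ) {v : ℝ} (hv : v ∈ Ioo 0 Real.pi) :
    Complex.exp (n * Complex.exp (logContour v) - n * logContour v) =
      (((cutModulus v)⁻¹ ^ n : ℝ) : ℂ) := by
  have hs := Real.sin_pos_of_pos_of_lt_pi hv.1 hv.2
  have hq : 0 < v / Real.sin v := div_pos hv.1 hs
  have hsc : (Complex.sin v) ≠ 0 := by
    rw [← Complex.ofReal_sin]
    exact_mod_cast hs.ne'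
  have h1 : Complex.exp (logContour v) = (v * (Real.cos v / Real.sin v) : ℝ) + v * Complex.I := by
    rw [logContour, Complex.exp_add, ← Complex.ofReal_exp, Real.exp_log hq, Complex.exp_mul_I]
    push_cast
    field_simp
  have h2 : Complex.exp (logContour v) - logContour v =
      ((v * (Real.cos v / Real.sin v) - Real.log (v / Real.sin v) : ℝ) : ℂ) := by
    rw [h1, logContour]
    push_cast
    ring
  rw [← mul_sub, h2, Complex.exp_nat_mul, ← Complex.ofReal_exp, ← Complex.ofReal_pow, cutModulus_eq,
    Real.exp_sub, Real.exp_log hq, mul_inv, Real.exp_neg, inv_inv, div_eq_inv_mul]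

theorem hasDerivAt_im_momentPrimitive_logContour (n : ℕ) {v : ℝ} (hv : v ∈ Ioo 0 Real.pi) :
    HasDerivAt (fun v => (momentPrimitive n (logContour v)).im) ((cutModulus v)⁻¹ ^ n) v := by
  have hs := Real.sin_pos_of_pos_of_lt_pi hv.1 hv.2
  have hq : 0 < v / Real.sin v := div_pos hv.1 hs
  have hl := (((hasDerivAt_id v).div (Real.hasDerivAt_sin v) hs.ne').log hq.ne')
  -- The value of d is irrelevant: the integrand is real on the curve, so d contributes only to the
  -- real part, while Im s' = 1.
  obtain ⟨d, hd⟩ : ∃ d, HasDerivAt (fun v => Real.log (v / Real.sin v)) d v := ⟨_, hl⟩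
  have hc : HasDerivAt logContour (d + 1 * Complex.I) v :=
    hd.ofReal_comp.add ((hasDerivAt_id v).ofReal_comp.mul_const Complex.I)
  have h := (hasDerivAt_momentPrimitive n (logContour v)).scomp v hc
  rw [exp_moment_logContour n hv] at h
  have h2 := Complex.imCLM.hasFDerivAt.comp_hasDerivAt v h
  refine h2.congr_deriv ?_
  simp only [Complex.imCLM_apply, smul_eq_mul, Complex.im_mul_ofReal]
  simp

theorem tendsto_div_sin : Tendsto (fun v : ℝ => v / Real.sin v) (𝓝[>] 0) (𝓝 1) := by
  have h : Tendsto (fun v => (Real.sinc v)⁻¹) (𝓝 0) (𝓝 1) := by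
    have := (Real.continuous_sinc.tendsto 0).inv₀ (by simp)
    simpa using this
  refine (h.mono_left nhdsWithin_le_nhds).congr' ?_
  filter_upwards [self_mem_nhdsWithin] with v hv
  rw [Real.sinc_of_ne_zero (ne_of_gt hv), inv_div]

theorem tendsto_logContour_zero : Tendsto logContour (𝓝[>] 0) (𝓝 0) := by
  have h1 : Tendsto (fun v : ℝ => ((Real.log (v / Real.sin v) : ℝ) : ℂ)) (𝓝[>] 0) (𝓝 0) := by
    have := (Complex.continuous_ofReal.tendsto _).comp (tendsto_div_sin.log one_ne_zero)
    simpa [Function.comp_def] using this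
  have h2 : Tendsto (fun v : ℝ => (v : ℂ) * Complex.I) (𝓝[>] 0) (𝓝 0) := by
    have h : Continuous fun v : ℝ => (v : ℂ) * Complex.I := by fun_prop
    have := h.tendsto 0
    simp only [Complex.ofReal_zero, zero_mul] at this
    exact this.mono_left nhdsWithin_le_nhds
  have h := h1.add h2
  rwa [add_zero] at h

/-- The contour escapes to infinity as v → π, so the primitive is compared with its value at the
same real part on Im s = π. On the vertical segment between them the integrand has modulus exp(n(e^l
cos t - l)) ≤ 1. -/
theorem norm_momentPrimitive_sub_le (n : ℕ) {l v : ℝ} (hl : 0 ≤ l)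
    (hv : v ∈ Ioo (Real.pi / 2) Real.pi) :
    ‖momentPrimitive n (l + Real.pi * Complex.I) - momentPrimitive n (l + v * Complex.I)‖ ≤
      Real.pi - v := by
  have hd : ∀ t : ℝ, HasDerivAt (fun t : ℝ => momentPrimitive n (l + t * Complex.I))
      ((1 * Complex.I) • Complex.exp (n * Complex.exp (l + t * Complex.I) -
        n * (l + t * Complex.I))) t := fun t =>
    (hasDerivAt_momentPrimitive n _).scomp t
      (((hasDerivAt_id t).ofReal_comp.mul_const Complex.I).const_add (l : ℂ))
  have hb : ∀ t ∈ Icc v Real.pi, ‖(1 * Complex.I) • Complex.exp (n * Complex.exp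
      (l + t * Complex.I) - n * (l + t * Complex.I))‖ ≤ 1 := by
    intro t ht
    have hc : Real.cos t ≤ 0 :=
      Real.cos_nonpos_of_pi_div_two_le_of_le (by linarith [hv.1, ht.1])
        (by linarith [ht.2, hv.1, Real.pi_pos])
    have hre : (n * Complex.exp (l + t * Complex.I) - n * (l + t * Complex.I)).re =
        n * (Real.exp l * Real.cos t - l) := by
      have : (Complex.exp (l + t * Complex.I)).re = Real.exp l * Real.cos t := by
        simp [Complex.exp_re]
      rw [← mul_sub, ← Complex.ofReal_natCast, Complex.re_ofReal_mul, Complex.sub_re, this]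
      simp
    rw [norm_smul, Complex.norm_exp, hre]
    simp only [one_mul, Complex.norm_I]
    rw [Real.exp_le_one_iff]
    exact mul_nonpos_of_nonneg_of_nonpos n.cast_nonneg
      (by linarith [mul_nonpos_of_nonneg_of_nonpos (Real.exp_pos l).le hc])
  have := (convex_Icc v Real.pi).norm_image_sub_le_of_norm_hasDerivWithin_le
    (fun t _ => (hd t).hasDerivWithinAt) hb (left_mem_Icc.2 hv.2.le) (right_mem_Icc.2 hv.2.le)
  rwa [one_mul, Real.norm_of_nonneg (by linarith [hv.2])] at this

theorem cutModulus_inv_le {v : ℝ} (hv : v ∈ Ioo 0 Real.pi) : (cutModulus v)⁻¹ ≤ Real.exp 1 := by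
  rw [← inv_inv (Real.exp 1)]
  exact inv_anti₀ (by positivity) (inv_exp_one_le_cutModulus hv)

theorem integrableOn_cutModulus_inv_pow (n : ℕ) :
    IntegrableOn (fun v => (cutModulus v)⁻¹ ^ n) (Ioo 0 Real.pi) := by
  refine Measure.integrableOn_of_bounded (M := Real.exp 1 ^ n) (by simp)
    (by fun_prop) ?_
  filter_upwards [ae_restrict_mem measurableSet_Ioo] with v hv
  have := inv_pos.2 (cutModulus_pos hv)
  rw [Real.norm_of_nonneg (by positivity)]
  gcongr
  exact cutModulus_inv_le hv

theorem integral_cutModulus_inv_pow (n : ℕ) :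
    ∫ v in Ioo 0 Real.pi, (cutModulus v)⁻¹ ^ n = (n : ℝ) ^ n / n.factorial * Real.pi := by
  rw [← integral_Ioc_eq_integral_Ioo, ← intervalIntegral.integral_of_le Real.pi_pos.le]
  rw [intervalIntegral.integral_eq_sub_of_hasDerivAt_of_tendsto
    (f := fun v => (momentPrimitive n (logContour v)).im) (fa := 0)
    (fb := (n : ℝ) ^ n / n.factorial * Real.pi) Real.pi_pos
    (fun v hv => hasDerivAt_im_momentPrimitive_logContour n hv)
    ((intervalIntegrable_iff_integrableOn_Ioo_of_le Real.pi_pos.le).2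
      (integrableOn_cutModulus_inv_pow n)) ?_ ?_, sub_zero]
  · have h := (hasDerivAt_momentPrimitive n 0).continuousAt.tendsto.comp tendsto_logContour_zero
    have h2 := (Complex.continuous_im.tendsto _).comp h
    have h3 := im_momentPrimitive_ofReal n 0
    rw [Complex.ofReal_zero] at h3
    rwa [h3] at h2
  · rw [tendsto_iff_norm_sub_tendsto_zero]
    have h : Tendsto (fun v : ℝ => Real.pi - v) (𝓝[<] Real.pi) (𝓝 0) := by
      have hc : Continuous fun v : ℝ => Real.pi - v := by fun_prop
      have := hc.tendsto Real.pi
      rw [sub_self] at this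
      exact this.mono_left nhdsWithin_le_nhds
    refine squeeze_zero' (Eventually.of_forall fun _ => norm_nonneg _) ?_ h
    filter_upwards [Ioo_mem_nhdsLT (show Real.pi / 2 < Real.pi by linarith [Real.pi_pos])] with v hv
    have hv' : v ∈ Ioo 0 Real.pi := ⟨by linarith [hv.1, Real.pi_pos], hv.2⟩
    have hl : 0 ≤ Real.log (v / Real.sin v) := Real.log_nonneg (one_le_div_sin hv')
    rw [← im_momentPrimitive_add_pi n (Real.log (v / Real.sin v)), logContour, norm_sub_rev,
      ← Complex.sub_im]
    exact (Complex.abs_im_le_norm _).trans (norm_momentPrimitive_sub_le n hl hv)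

/-! ### The Lambert series near 0 -/

/-- Termwise integration of the logarithmic series, dominated by the geometric series in z e since
1/b ≤ e. The factor 1/(n+1) of the logarithm turns the moment (n+1)^{n+1}/(n+1)! into
(n+1)^n/(n+1)!. -/
theorem hasSum_integral_log {z : ℝ} (hz : 0 ≤ z) (hz1 : z * Real.exp 1 < 1) :
    HasSum (fun n : ℕ => (-1) ^ n * ((n + 1 : ℝ) ^ n / (n + 1).factorial) * z ^ (n + 1))
      ((1 / Real.pi) * ∫ v in Ioo 0 Real.pi, Real.log (1 + z * (cutModulus v)⁻¹)) := by
  have hle : ∀ v ∈ Ioo 0 Real.pi, z * (cutModulus v)⁻¹ ≤ z * Real.exp 1 := fun v hv => by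
    gcongr
    exact cutModulus_inv_le hv
  have hnn : ∀ v ∈ Ioo 0 Real.pi, 0 ≤ z * (cutModulus v)⁻¹ := fun v hv =>
    mul_nonneg hz (inv_pos.2 (cutModulus_pos hv)).le
  have h0 : 0 ≤ z * Real.exp 1 := by positivity
  have hgeo : Summable fun n : ℕ => (z * Real.exp 1) ^ (n + 1) :=
    (summable_nat_add_iff 1).2 (summable_geometric_of_lt_one h0 hz1)
  have key := hasSum_integral_of_dominated_convergence (μ := volume.restrict (Ioo 0 Real.pi))
    (F := fun (n : ℕ) v => -((-(z * (cutModulus v)⁻¹)) ^ (n + 1) / (n + 1)))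
    (f := fun v => Real.log (1 + z * (cutModulus v)⁻¹))
    (fun n _ => (z * Real.exp 1) ^ (n + 1)) (fun n => by fun_prop) (fun n => by
      filter_upwards [ae_restrict_mem measurableSet_Ioo] with v hv
      rw [norm_neg, norm_div, norm_pow, norm_neg, Real.norm_of_nonneg (hnn v hv),
        Real.norm_of_nonneg (by positivity)]
      refine (div_le_self (pow_nonneg (hnn v hv) _) (by linarith [n.cast_nonneg (α := ℝ)])).trans ?_
      exact pow_le_pow_left₀ (hnn v hv) (hle v hv) _)
    (Eventually.of_forall fun _ => hgeo) (integrable_const _) (by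
      filter_upwards [ae_restrict_mem measurableSet_Ioo] with v hv
      have := (Real.hasSum_pow_div_log_of_abs_lt_one (x := -(z * (cutModulus v)⁻¹)) (by
        rw [abs_neg, abs_of_nonneg (hnn v hv)]
        exact (hle v hv).trans_lt hz1)).neg
      rwa [neg_neg, sub_neg_eq_add] at this)
  refine (key.mul_left (1 / Real.pi)).congr_fun fun n => ?_
  have : ∀ v, -((-(z * (cutModulus v)⁻¹)) ^ (n + 1) / (n + 1)) =
      (-(-z) ^ (n + 1) / (n + 1)) * (cutModulus v)⁻¹ ^ (n + 1) := fun v => by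
    rw [← neg_mul, mul_pow]
    ring
  simp only [this]
  rw [integral_const_mul, integral_cutModulus_inv_pow, neg_pow z]
  have : (n + 1 : ℝ) ≠ 0 := by positivity
  push_cast
  field_simp
  ring

/-- Up to a constant factor, for N > 0 this is the (N+1)-st finite difference of x^N at 0, which
vanishes; the missing node j = 0 contributes nothing because 0^N = 0. -/
theorem sum_antidiagonal_eq_ite (N : ℕ) :
    ∑ p ∈ Finset.HasAntidiagonal.antidiagonal N, (-1 : ℝ) ^ p.1 * ((p.1 + 1 : ℝ) ^ N /
      ((p.1 + 1).factorial * p.2.factorial)) = if N = 0 then 1 else 0 := by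
  rcases Nat.eq_zero_or_pos N with rfl | hN
  · simp
  rw [if_neg hN.ne']
  have h := congrFun (fwdDiff_iter_pow_eq_zero_of_lt (R := ℝ) N.lt_succ_self) 0
  rw [fwdDiff_iter_eq_sum_shift, Finset.sum_range_succ'] at h
  simp only [zero_smul, add_zero, zero_pow hN.ne', smul_zero, Pi.zero_apply] at h
  rw [Finset.Nat.sum_antidiagonal_eq_sum_range_succ_mk]
  have h2 : ∀ k ∈ Finset.range (N + 1), (-1 : ℝ) ^ k * ((k + 1 : ℝ) ^ N /
      ((k + 1).factorial * (N - k).factorial)) = ((-1) ^ N / (N + 1).factorial) *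
      (((-1 : ℤ) ^ (N.succ - (k + 1)) * (N.succ.choose (k + 1) : ℤ)) •
        (0 + (k + 1) • (1 : ℝ)) ^ N) := by
    intro k hk
    have hk' : k ≤ N := Nat.lt_succ_iff.1 (Finset.mem_range.1 hk)
    have h3 := Nat.choose_mul_factorial_mul_factorial (Nat.succ_le_succ hk')
    rw [Nat.succ_sub_succ] at h3 ⊢
    have h4 : ((N.succ.choose (k + 1) : ℕ) : ℝ) = (N + 1).factorial /
        ((k + 1).factorial * (N - k).factorial) := by
      rw [eq_div_iff (by positivity), ← mul_assoc]
      exact_mod_cast h3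
    have h5 : (-1 : ℝ) ^ k = (-1) ^ N * (-1) ^ (N - k) := by
      rw [← pow_add, show N + (N - k) = k + 2 * (N - k) by omega, pow_add, pow_mul]
      simp
    rw [zsmul_eq_mul, h5]
    push_cast
    rw [h4]
    simp only [zero_add, nsmul_eq_mul, Nat.cast_add, Nat.cast_one, mul_one]
    have : ((N + 1).factorial : ℝ) ≠ 0 := by positivity
    field_simp
  rw [Finset.sum_congr rfl h2, ← Finset.mul_sum, h, mul_zero]

/-- Expanding e^{(n+1)w} gives an absolutely convergent double series. Its terms of degree N + 1 in
w form an antidiagonal, which cancels by `sum_antidiagonal_eq_ite` except for N = 0, leaving w. -/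
theorem hasSum_lambert_series {w : ℝ} (hw : 0 ≤ w)
    (hw1 : w * Real.exp w * Real.exp 1 < 1) :
    HasSum (fun n : ℕ => (-1) ^ n * ((n + 1 : ℝ) ^ n / (n + 1).factorial) *
      (w * Real.exp w) ^ (n + 1)) w := by
  set c : ℕ × ℕ → ℝ := fun p => (p.1 + 1 : ℝ) ^ p.1 / (p.1 + 1).factorial * w ^ (p.1 + 1) *
    (((p.1 + 1) * w) ^ p.2 / p.2.factorial)
  have hc0 : ∀ p, 0 ≤ c p := fun p => by positivity
  have hrow : ∀ n : ℕ, HasSum (fun k => c (n, k))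
      ((n + 1 : ℝ) ^ n / (n + 1).factorial * (w * Real.exp w) ^ (n + 1)) := by
    intro n
    have h := (NormedSpace.expSeries_div_hasSum_exp ((n + 1 : ℝ) * w)).mul_left
      ((n + 1 : ℝ) ^ n / (n + 1).factorial * w ^ (n + 1))
    rw [← Real.exp_eq_exp_ℝ] at h
    have he : Real.exp ((n + 1) * w) = Real.exp w ^ (n + 1) := by
      rw [← Real.exp_nat_mul]
      push_cast
      rfl
    rwa [he, mul_assoc, ← mul_pow] at h
  have hcs : Summable c := by
    refine (summable_prod_of_nonneg hc0).2 ⟨fun n => (hrow n).summable, ?_⟩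
    simp only [(hrow _).tsum_eq]
    refine Summable.of_nonneg_of_le (fun n => by positivity) (fun n => ?_)
      ((summable_nat_add_iff 1).2 (summable_geometric_of_lt_one (by positivity) hw1))
    -- From x^m/m! ≤ e^x at x = m = n + 1; it yields a geometric majorant of ratio w e^w e < 1.
    have h1 : (n + 1 : ℝ) ^ n / (n + 1).factorial ≤ Real.exp 1 ^ (n + 1) := by
      have h2 := Real.pow_div_factorial_le_exp (n + 1 : ℝ) (by positivity) (n + 1)
      rw [← Real.exp_nat_mul, mul_one]
      push_cast
      refine le_trans ?_ h2
      gcongr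
      · linarith [n.cast_nonneg (α := ℝ)]
      · omega
    rw [mul_pow _ (Real.exp 1), mul_comm]
    gcongr
  set a : ℕ × ℕ → ℝ := fun p => (-1) ^ p.1 * c p
  have has : Summable a := Summable.of_norm_bounded hcs fun p => by
    simp [a, abs_of_nonneg (hc0 p)]
  have hfib : ∀ n : ℕ, HasSum (fun k => a (n, k)) ((-1) ^ n * ((n + 1 : ℝ) ^ n /
      (n + 1).factorial) * (w * Real.exp w) ^ (n + 1)) := fun n => by
    rw [mul_assoc]
    exact (hrow n).mul_left _
  have htot : ∑' p, a p = w := by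
    have hs := Finset.HasAntidiagonal.sigmaAntidiagonalEquivProd.summable_iff.2 has
    refine (Finset.HasAntidiagonal.sigmaAntidiagonalEquivProd.tsum_eq a).symm.trans
      (hs.tsum_sigma.trans ?_)
    have : ∀ N : ℕ, ∑' p : Finset.HasAntidiagonal.antidiagonal N, a (Finset.HasAntidiagonal.sigmaAntidiagonalEquivProd ⟨N, p⟩) =
        if N = 0 then w else 0 := by
      intro N
      rw [tsum_fintype]
      have h1 : ∀ p ∈ Finset.HasAntidiagonal.antidiagonal N, a p = w ^ (N + 1) * ((-1 : ℝ) ^ p.1 *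
          ((p.1 + 1 : ℝ) ^ N / ((p.1 + 1).factorial * p.2.factorial))) := by
        intro p hp
        rw [← Finset.HasAntidiagonal.mem_antidiagonal.1 hp]
        simp only [a, c]
        rw [mul_pow, pow_add _ p.1 p.2]
        field_simp
        ring
      simp only [Finset.HasAntidiagonal.sigmaAntidiagonalEquivProd_apply]
      rw [Finset.sum_coe_sort (Finset.HasAntidiagonal.antidiagonal N) a, Finset.sum_congr rfl h1, ← Finset.mul_sum,
        sum_antidiagonal_eq_ite]
      split_ifs with h <;> simp [h]
    simp only [Function.comp_apply, this, tsum_ite_eq]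
  have := has.hasSum.prod_fiberwise hfib
  rwa [htot] at this

theorem integral_log_mul_exp {w : ℝ} (hw : 0 ≤ w) (hw1 : w * Real.exp w * Real.exp 1 < 1) :
    (1 / Real.pi) * ∫ v in Ioo 0 Real.pi, Real.log (1 + w * Real.exp w * (cutModulus v)⁻¹) = w :=
  (hasSum_integral_log (by positivity) hw1).unique (hasSum_lambert_series hw hw1)

/-! ### The logarithmic integral and its analytic continuation -/

/-- An integral expression of the principal branch off the cut. -/
noncomputable def logIntegral (z : ℂ) : ℂ :=
  (1 / Real.pi : ℝ) * ∫ v in Ioo 0 Real.pi, Complex.log (1 + z * ((cutModulus v)⁻¹ : ℝ))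

theorem isOpen_branchCut_compl : IsOpen branchCutᶜ := by
  rw [branchCut_compl_eq]
  exact Complex.isOpen_slitPlane.preimage (by fun_prop)

theorem isPreconnected_branchCut_compl : IsPreconnected branchCutᶜ := by
  have h : branchCutᶜ = (fun z : ℂ => z - ((Real.exp 1)⁻¹ : ℝ)) '' Complex.slitPlane := by
    rw [branchCut_compl_eq]
    ext z
    constructor
    · intro hz
      exact ⟨_, hz, by simp⟩
    · rintro ⟨w, hw, rfl⟩
      simpa using hw
  rw [h]
  exact (Complex.starConvex_one_slitPlane.isPathConnected
    Complex.one_mem_slitPlane).isConnected.isPreconnected.image _ (by fun_prop)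

theorem mem_branchCut_compl_of_re_nonneg {z : ℂ} (hz : 0 ≤ z.re) : z ∈ branchCutᶜ := by
  rw [branchCut_compl_eq]
  left
  simp only [Complex.add_re, Complex.ofReal_re]
  positivity

/-- If 1 + zt were a nonpositive real, z would be real with z ≤ -1/t ≤ -1/e, hence on the cut. -/
theorem one_add_mul_mem_slitPlane {z : ℂ} (hz : z ∈ branchCutᶜ) {t : ℝ} (ht : 0 ≤ t)
    (ht1 : t ≤ Real.exp 1) : 1 + z * t ∈ Complex.slitPlane := by
  rw [branchCut_compl_eq, mem_preimage, Complex.mem_slitPlane_iff] at hz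
  rw [Complex.mem_slitPlane_iff]
  simp only [Complex.add_re, Complex.one_re, Complex.re_mul_ofReal, Complex.add_im,
    Complex.one_im, Complex.im_mul_ofReal, zero_add, Complex.ofReal_re, Complex.ofReal_im,
    add_zero] at hz ⊢
  rcases hz with hz | hz
  · left
    rcases le_total 0 z.re with h | h
    · positivity
    · have h1 : z.re * Real.exp 1 ≤ z.re * t := mul_le_mul_of_nonpos_left ht1 h
      have h2 : 0 < (z.re + (Real.exp 1)⁻¹) * Real.exp 1 := by positivity
      rw [add_mul, inv_mul_cancel₀ (Real.exp_pos 1).ne'] at h2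
      linarith
  · rcases ht.eq_or_lt with rfl | h
    · left
      simp
    · right
      exact mul_ne_zero hz h.ne'

theorem one_add_mul_inv_mem_slitPlane {z : ℂ} (hz : z ∈ branchCutᶜ) {v : ℝ}
    (hv : v ∈ Ioo 0 Real.pi) : 1 + z * ((cutModulus v)⁻¹ : ℝ) ∈ Complex.slitPlane :=
  one_add_mul_mem_slitPlane hz (inv_pos.2 (cutModulus_pos hv)).le (cutModulus_inv_le hv)

theorem measurable_log_integrand (z : ℂ) :
    Measurable fun v => Complex.log (1 + z * ((cutModulus v)⁻¹ : ℝ)) := by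
  fun_prop

/-- The integrand is bounded, being log(1 + zt), continuous on the compact interval [0, e],
evaluated at t = 1/b(v). -/
theorem integrableOn_log {z : ℂ} (hz : z ∈ branchCutᶜ) :
    IntegrableOn (fun v => Complex.log (1 + z * ((cutModulus v)⁻¹ : ℝ))) (Ioo 0 Real.pi) := by
  have hc : ContinuousOn (fun t : ℝ => Complex.log (1 + z * t)) (Icc 0 (Real.exp 1)) :=
    ContinuousOn.clog (by fun_prop) fun t ht => one_add_mul_mem_slitPlane hz ht.1 ht.2
  obtain ⟨C, hC⟩ := isCompact_Icc.exists_bound_of_continuousOn hc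
  refine Measure.integrableOn_of_bounded (M := C) (by simp)
    (measurable_log_integrand z).aestronglyMeasurable ?_
  filter_upwards [ae_restrict_mem measurableSet_Ioo] with v hv
  exact hC _ ⟨(inv_pos.2 (cutModulus_pos hv)).le, cutModulus_inv_le hv⟩

theorem differentiableOn_logIntegral : DifferentiableOn ℂ logIntegral branchCutᶜ := by
  intro z hz
  obtain ⟨δ, hδ, hball⟩ := Metric.isOpen_iff.1 isOpen_branchCut_compl z hz
  have hsub : Metric.ball z (δ / 2) ⊆ Metric.ball z δ := Metric.ball_subset_ball (by linarith)
  have h := hasDerivAt_integral_of_dominated_loc_of_deriv_le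
    (μ := volume.restrict (Ioo 0 Real.pi)) (x₀ := z) (s := Metric.ball z (δ / 2))
    (F := fun z v => Complex.log (1 + z * ((cutModulus v)⁻¹ : ℝ)))
    (F' := fun z v => (1 * ((cutModulus v)⁻¹ : ℝ)) / (1 + z * ((cutModulus v)⁻¹ : ℝ)))
    (bound := fun _ => (δ / 2)⁻¹)
    (Metric.ball_mem_nhds z (by positivity))
    (Eventually.of_forall fun z => (measurable_log_integrand z).aestronglyMeasurable)
    (integrableOn_log hz)
    (Measurable.aestronglyMeasurable (by fun_prop))
    (by
      filter_upwards [ae_restrict_mem measurableSet_Ioo] with v hv y hy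
      have hb := cutModulus_pos hv
      have hb' : (cutModulus v : ℂ) ≠ 0 := by exact_mod_cast hb.ne'
      have hcut : ((-cutModulus v : ℝ) : ℂ) ∈ branchCut :=
        ⟨_, neg_le_neg (inv_exp_one_le_cutModulus hv), rfl⟩
      -- The z-derivative of the integrand is 1/(b + z). As -b lies on the cut, outside the δ-ball
      -- around z, |b + y| ≥ δ/2 on the half-radius ball, uniformly in v.
      have h1 : δ ≤ dist ((-cutModulus v : ℝ) : ℂ) z := by
        by_contra hlt
        exact hball (Metric.mem_ball.2 (not_le.1 hlt)) hcut
      have h2 : δ / 2 ≤ ‖(cutModulus v : ℂ) + y‖ := by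
        have h3 := dist_triangle_right ((-cutModulus v : ℝ) : ℂ) z y
        rw [dist_eq_norm _ y, dist_comm z y, Complex.ofReal_neg, ← neg_add', norm_neg] at h3
        have := Metric.mem_ball.1 hy
        push_cast at h1
        linarith
      have h4 : (1 * ((cutModulus v)⁻¹ : ℝ)) / (1 + y * ((cutModulus v)⁻¹ : ℝ)) =
          ((cutModulus v : ℂ) + y)⁻¹ := by
        push_cast
        rw [one_mul, ← div_eq_mul_inv, one_add_div hb', div_div_eq_mul_div,
          inv_mul_cancel₀ hb', one_div]
      rw [h4, norm_inv]
      exact inv_anti₀ (by positivity) h2)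
    (integrable_const _)
    (by
      filter_upwards [ae_restrict_mem measurableSet_Ioo] with v hv y hy
      exact (((hasDerivAt_id y).mul_const _).const_add 1).clog
        (one_add_mul_inv_mem_slitPlane (hball (hsub hy)) hv))
  exact (h.2.const_mul _).differentiableAt.differentiableWithinAt

theorem logIntegral_ofReal {x : ℝ} (hx : 0 ≤ x) : logIntegral x =
    (((1 / Real.pi) * ∫ v in Ioo 0 Real.pi, Real.log (1 + x * (cutModulus v)⁻¹) : ℝ) : ℂ) := by
  rw [logIntegral, Complex.ofReal_mul, ← integral_complex_ofReal]
  congr 1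
  refine setIntegral_congr_fun measurableSet_Ioo fun v hv => ?_
  have := inv_pos.2 (cutModulus_pos hv)
  rw [Complex.ofReal_log (by positivity)]
  push_cast
  rfl

/-- Identity theorem on the connected cut plane: the two sides agree at the points w e^w for small w
> 0, which accumulate at 0. -/
theorem logIntegral_mul_exp {z : ℂ} (hz : z ∈ branchCutᶜ) :
    logIntegral z * Complex.exp (logIntegral z) = z := by
  have h0 : (0 : ℂ) ∈ branchCutᶜ := mem_branchCut_compl_of_re_nonneg le_rfl
  have hd : DifferentiableOn ℂ (fun z => logIntegral z * Complex.exp (logIntegral z)) branchCutᶜ :=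
    differentiableOn_logIntegral.mul differentiableOn_logIntegral.cexp
  refine (hd.analyticOnNhd isOpen_branchCut_compl).eqOn_of_preconnected_of_frequently_eq
    (g := fun z => z) (differentiableOn_id.analyticOnNhd isOpen_branchCut_compl)
    isPreconnected_branchCut_compl h0 ?_ hz
  have hc : Continuous fun w : ℝ => w * Real.exp w := by fun_prop
  have ht : Tendsto (fun w : ℝ => ((w * Real.exp w : ℝ) : ℂ)) (𝓝[>] 0) (𝓝[≠] 0) := by
    refine tendsto_nhdsWithin_iff.2 ⟨?_, ?_⟩
    · have := (Complex.continuous_ofReal.comp hc).tendsto 0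
      simp only [Function.comp_apply, zero_mul, Complex.ofReal_zero] at this
      exact this.mono_left nhdsWithin_le_nhds
    · filter_upwards [self_mem_nhdsWithin] with w hw
      have : 0 < w * Real.exp w := mul_pos hw (Real.exp_pos w)
      simpa only [mem_compl_iff, mem_singleton_iff, Complex.ofReal_eq_zero] using this.ne'
  refine ht.frequently (Eventually.frequently ?_)
  have hsmall : ∀ᶠ w : ℝ in 𝓝[>] 0, w * Real.exp w * Real.exp 1 < 1 := by
    refine nhdsWithin_le_nhds ((hc.mul_const (Real.exp 1)).tendsto 0 |>.eventually_lt_const ?_)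
    simp
  filter_upwards [self_mem_nhdsWithin, hsmall] with w hw hw1
  have hw0 : (0 : ℝ) ≤ w := le_of_lt hw
  rw [logIntegral_ofReal (by positivity), integral_log_mul_exp hw0 hw1]
  push_cast
  rfl

theorem logIntegral_pos {x : ℝ} (hx : 0 < x) :
    0 < (logIntegral x).re ∧ (logIntegral x).im = 0 := by
  rw [logIntegral_ofReal hx.le, Complex.ofReal_re, Complex.ofReal_im]
  refine ⟨mul_pos (by positivity) ?_, rfl⟩
  have hi : IntegrableOn (fun v => Real.log (1 + x * (cutModulus v)⁻¹)) (Ioo 0 Real.pi) := by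
    have hx' : (x : ℂ) ∈ branchCutᶜ := mem_branchCut_compl_of_re_nonneg (by simpa using hx.le)
    refine (IntegrableOn.congr_fun (integrableOn_log hx').re ?_ measurableSet_Ioo)
    intro v hv
    have := inv_pos.2 (cutModulus_pos hv)
    simp only [RCLike.re_to_complex]
    rw [← Complex.ofReal_mul, ← Complex.ofReal_one, ← Complex.ofReal_add,
      ← Complex.ofReal_log (by positivity), Complex.ofReal_re]
  rw [← integral_Ioc_eq_integral_Ioo, ← intervalIntegral.integral_of_le Real.pi_pos.le]
  refine intervalIntegral.intervalIntegral_pos_of_pos_on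
    ((intervalIntegrable_iff_integrableOn_Ioo_of_le Real.pi_pos.le).2 hi) ?_ Real.pi_pos
  intro v hv
  have := inv_pos.2 (cutModulus_pos hv)
  exact Real.log_pos (by linarith [mul_pos hx this])

/-! ### Values on the cut and existence of the principal branch -/

/-- Intermediate values: b tends to 1/e at 0 and to infinity at π, where b(v) ≥ v / sin v because
cos v ≤ 0. -/
theorem Ioi_subset_image_cutModulus :
    Ioi (Real.exp 1)⁻¹ ⊆ cutModulus '' Ioo 0 Real.pi := by
  have h0 : Tendsto cutModulus (𝓝[>] 0) (𝓝 (Real.exp 1)⁻¹) := by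
    have hc : Tendsto Real.cos (𝓝[>] 0) (𝓝 1) := by
      have := Real.continuous_cos.tendsto 0
      rw [Real.cos_zero] at this
      exact this.mono_left nhdsWithin_le_nhds
    have h := tendsto_div_sin.mul ((Real.continuous_exp.tendsto _).comp
      (tendsto_div_sin.mul hc).neg)
    rw [one_mul, one_mul, Real.exp_neg] at h
    refine h.congr fun v => ?_
    rw [cutModulus_eq, Function.comp_apply, div_mul_eq_mul_div v _ (Real.cos v), mul_div_assoc]
  have hpi : Tendsto cutModulus (𝓝[<] Real.pi) atTop := by
    have hs : Tendsto Real.sin (𝓝[<] Real.pi) (𝓝[>] 0) := by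
      refine tendsto_nhdsWithin_iff.2 ⟨?_, ?_⟩
      · have := Real.continuous_sin.tendsto Real.pi
        rw [Real.sin_pi] at this
        exact this.mono_left nhdsWithin_le_nhds
      · filter_upwards [Ioo_mem_nhdsLT Real.pi_pos] with v hv
        exact Real.sin_pos_of_pos_of_lt_pi hv.1 hv.2
    have h := Tendsto.pos_mul_atTop Real.pi_pos
      ((continuous_id.tendsto Real.pi).mono_left nhdsWithin_le_nhds)
      (tendsto_inv_nhdsGT_zero.comp hs)
    refine tendsto_atTop_mono' _ ?_ h
    filter_upwards [Ioo_mem_nhdsLT (show Real.pi / 2 < Real.pi by linarith [Real.pi_pos])] with v hv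
    have hv' : v ∈ Ioo 0 Real.pi := ⟨by linarith [hv.1, Real.pi_pos], hv.2⟩
    have hsin := Real.sin_pos_of_pos_of_lt_pi hv'.1 hv'.2
    have hcos : Real.cos v ≤ 0 :=
      Real.cos_nonpos_of_pi_div_two_le_of_le hv.1.le (by linarith [hv.2, Real.pi_pos])
    rw [cutModulus_eq, id, Function.comp_apply, ← div_eq_mul_inv]
    refine le_mul_of_one_le_right (zero_le_one.trans (one_le_div_sin hv')) (Real.one_le_exp ?_)
    exact neg_nonneg.2 (mul_nonpos_of_nonneg_of_nonpos hv'.1.le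
      (div_nonpos_of_nonpos_of_nonneg hcos hsin.le))
  exact isPreconnected_Ioo.intermediate_value_Ioi
    (le_principal_iff.2 (Ioo_mem_nhdsGT Real.pi_pos))
    (le_principal_iff.2 (Ioo_mem_nhdsLT Real.pi_pos)) continuousOn_cutModulus h0 hpi

/-- Take w = -v cot v + iv = -(v / sin v) e^{-iv}. The phases cancel in w e^w, leaving -b(v), and v
is chosen with b(v) = -t. -/
theorem exists_mul_exp_eq_of_lt {t : ℝ} (ht : t < -(Real.exp 1)⁻¹) :
    ∃ w : ℂ, w * Complex.exp w = t ∧ w.im ∈ Ioo 0 Real.pi := by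
  obtain ⟨v, hv, hvt⟩ := Ioi_subset_image_cutModulus (show -t ∈ Ioi _ from lt_neg.1 ht)
  have hs := Real.sin_pos_of_pos_of_lt_pi hv.1 hv.2
  have hsc : Complex.sin v ≠ 0 := by
    rw [← Complex.ofReal_sin]
    exact_mod_cast hs.ne'
  refine ⟨(-(v * (Real.cos v / Real.sin v)) : ℝ) + v * Complex.I, ?_, by
    rwa [Complex.add_im, Complex.ofReal_im, zero_add, Complex.im_ofReal_mul, Complex.I_im, mul_one]⟩
  have h1 : t = -cutModulus v := by rw [hvt, neg_neg]
  rw [Complex.exp_add, Complex.exp_mul_I, ← Complex.ofReal_exp, h1, cutModulus_eq]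
  push_cast
  field_simp
  linear_combination (v : ℂ) * (Complex.sin v ^ 2 * Complex.I_sq - Complex.sin_sq_add_cos_sq v)

open Classical in
theorem exists_isPrincipalBranch :
    ∃ W : ℂ → ℂ, IsPrincipalBranch W ∧ EqOn W logIntegral branchCutᶜ := by
  choose! c hc using fun t : ℝ => exists_mul_exp_eq_of_lt (t := t)
  -- The value -1 is used only at the branch point, since (-1) e^{-1} = -1/e.
  set W : ℂ → ℂ := fun z => if z ∈ branchCutᶜ then logIntegral z else
    if z.re < -(Real.exp 1)⁻¹ then c z.re else -1
  have hW : EqOn W logIntegral branchCutᶜ := fun z hz => if_pos hz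
  have hcut : ∀ t : ℝ, t < -(Real.exp 1)⁻¹ → W t = c t := fun t ht => by
    have h : (t : ℂ) ∉ branchCutᶜ := not_not.2 ⟨t, ht.le, rfl⟩
    simp only [W, if_neg h, Complex.ofReal_re, if_pos ht]
  have hbranch : W ((-(Real.exp 1)⁻¹ : ℝ) : ℂ) = -1 := by
    have h : ((-(Real.exp 1)⁻¹ : ℝ) : ℂ) ∉ branchCutᶜ := not_not.2 ⟨_, self_mem_Iic, rfl⟩
    simp only [W, if_neg h, Complex.ofReal_re, lt_irrefl, if_false]
  refine ⟨W, ⟨?_, differentiableOn_logIntegral.congr hW, ?_, ?_, ?_⟩, hW⟩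
  · intro z
    by_cases hz : z ∈ branchCutᶜ
    · rw [hW hz, logIntegral_mul_exp hz]
    · obtain ⟨t, ht, rfl⟩ := not_not.1 hz
      rcases (mem_Iic.1 ht).lt_or_eq with h | rfl
      · simp only [hcut t h, (hc t h).1]
      · simp only [hbranch]
        push_cast
        rw [Complex.exp_neg]
        ring
  · intro x hx
    rw [hW (mem_branchCut_compl_of_re_nonneg (by simpa using hx.le))]
    exact logIntegral_pos hx
  · intro t ht
    rw [hcut t ht]
    exact (hc t ht).2
  · rw [hbranch]
    simp

theorem lambertW_eq_logIntegral {z : ℂ} (hz : z ∈ branchCutᶜ) : lambertW z = logIntegral z := by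
  obtain ⟨W, hW, he⟩ := exists_isPrincipalBranch
  have h : ∃ W : ℂ → ℂ, IsPrincipalBranch W := ⟨W, hW⟩
  rw [lambertW, dif_pos h, h.choose_spec.eqOn hW hz, he hz]

/-! ### Frullani-type formula and exchange of integrals -/

/-- Mean value inequality on the convex half-plane Re w ≥ 0, where e^{-w} has derivative of modulus
at most 1. It controls the singularity 1/ξ at 0. -/
theorem norm_one_sub_exp_neg_le {w : ℂ} (hw : 0 ≤ w.re) : ‖1 - Complex.exp (-w)‖ ≤ ‖w‖ := by
  have h := (convex_halfSpace_re_ge 0).norm_image_sub_le_of_norm_hasDerivWithin_le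
    (f := fun w => Complex.exp (-w)) (f' := fun w => Complex.exp (-w) * (-1)) (C := 1) (x := 0)
    (y := w) (fun w _ => (hasDerivAt_neg w).cexp.hasDerivWithinAt) (fun w hw => by
      have hw' : 0 ≤ w.re := hw
      rw [norm_mul, norm_neg, norm_one, mul_one, Complex.norm_exp, Real.exp_le_one_iff,
        Complex.neg_re]
      linarith) (by simp) hw
  rwa [neg_zero, Complex.exp_zero, norm_sub_rev, one_mul, sub_zero] at h

theorem norm_one_sub_exp_div_le {z : ℂ} (hz : 0 ≤ z.re) {ξ : ℝ} (hξ : 0 < ξ) :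
    ‖(1 - Complex.exp (-z * (ξ : ℂ))) / (ξ : ℂ)‖ ≤ ‖z‖ := by
  rw [norm_div, Complex.norm_of_nonneg hξ.le, div_le_iff₀ hξ, neg_mul]
  refine (norm_one_sub_exp_neg_le ?_).trans_eq ?_
  · rw [Complex.re_mul_ofReal]
    positivity
  · rw [norm_mul, Complex.norm_of_nonneg hξ.le]

theorem integrable_prod_of_norm_le_exp {S : Set ℝ} (hS : MeasurableSet S) (hS' : volume S ≠ ⊤)
    {f : ℝ × ℝ → ℂ} (hf : Measurable f) {C c : ℝ} (hc : 0 < c)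
    (hb : ∀ ξ, 0 < ξ → ∀ v ∈ S, ‖f (ξ, v)‖ ≤ C * Real.exp (-c * ξ)) :
    Integrable f ((volume.restrict (Ioi 0)).prod (volume.restrict S)) := by
  have : IsFiniteMeasure (volume.restrict S) := ⟨by
    rw [Measure.restrict_apply_univ]
    exact hS'.lt_top⟩
  have hexp : IntegrableOn (fun ξ : ℝ => Real.exp (-c * ξ)) (Ioi 0) :=
    integrableOn_exp_mul_Ioi (neg_lt_zero.2 hc) 0
  refine ((hexp.const_mul C).comp_fst (volume.restrict S)).mono' hf.aestronglyMeasurable ?_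
  rw [Measure.prod_restrict]
  filter_upwards [ae_restrict_mem (measurableSet_Ioi.prod hS)] with p hp
  exact hb p.1 hp.1 p.2 hp.2

/-- The integrand equals ∫ z e^{-(sz+B)ξ} ds over 0 ≤ s ≤ 1. Integrating in ξ first leaves z/(sz +
B), the s-derivative of log(1 + sz/B), whose argument stays in the right half-plane. -/
theorem integral_one_sub_exp_div_mul_exp {z : ℂ} (hz : 0 ≤ z.re) {B : ℝ} (hB : 0 < B) :
    ∫ ξ in Ioi (0 : ℝ), (1 - Complex.exp (-z * (ξ : ℂ))) / (ξ : ℂ) * (Real.exp (-ξ * B) : ℂ) =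
      Complex.log (1 + z * (B⁻¹ : ℝ)) := by
  have hBc : (B : ℂ) ≠ 0 := by exact_mod_cast hB.ne'
  have h1 : ∀ ξ ∈ Ioi (0 : ℝ),
      (1 - Complex.exp (-z * (ξ : ℂ))) / (ξ : ℂ) * (Real.exp (-ξ * B) : ℂ) =
        ∫ s in Ioc (0 : ℝ) 1, z * Complex.exp (-(s * z + B) * ξ) := by
    intro ξ hξ
    have hξ' : (ξ : ℂ) ≠ 0 := by exact_mod_cast (ne_of_gt hξ)
    have hd : ∀ s ∈ uIcc (0 : ℝ) 1, HasDerivAt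
        (fun s : ℝ => -Complex.exp (-(s * z + B) * ξ) / ξ)
        (z * Complex.exp (-(s * z + B) * ξ)) s := by
      intro s _
      have h := (((((((hasDerivAt_id s).ofReal_comp.mul_const z).add_const (B : ℂ)).neg).mul_const
        (ξ : ℂ)).cexp).neg).div_const (ξ : ℂ)
      refine h.congr_deriv ?_
      simp only [id, Complex.ofReal_one, Pi.neg_apply]
      field_simp
    rw [← intervalIntegral.integral_of_le zero_le_one,
      intervalIntegral.integral_eq_sub_of_hasDerivAt hd
        (Continuous.intervalIntegrable (by fun_prop) _ _)]
    have he : Complex.exp (-((1 : ℝ) * z + B) * ξ) =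
        Complex.exp (-z * ξ) * (Real.exp (-ξ * B) : ℂ) := by
      rw [Complex.ofReal_exp, ← Complex.exp_add]
      congr 1
      push_cast
      ring
    have he0 : Complex.exp (-((0 : ℝ) * z + B) * ξ) = (Real.exp (-ξ * B) : ℂ) := by
      rw [Complex.ofReal_exp]
      congr 1
      push_cast
      ring
    rw [he, he0]
    ring
  have h2 : Integrable (Function.uncurry fun (ξ s : ℝ) => z * Complex.exp (-(s * z + B) * ξ))
      ((volume.restrict (Ioi 0)).prod (volume.restrict (Ioc 0 1))) := by
    refine integrable_prod_of_norm_le_exp measurableSet_Ioc (by simp) (C := ‖z‖)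
      (Continuous.measurable (by fun_prop)) hB fun ξ hξ s hs => ?_
    simp only [Function.uncurry]
    rw [norm_mul, Complex.norm_exp]
    gcongr
    rw [Complex.re_mul_ofReal, Complex.neg_re, Complex.add_re, Complex.re_ofReal_mul,
      Complex.ofReal_re]
    have := mul_nonneg (mul_nonneg hs.1.le hz) hξ.le
    nlinarith
  have hslit : ∀ s ∈ Icc (0 : ℝ) 1, 1 + (s : ℂ) * (z * (B⁻¹ : ℝ)) ∈ Complex.slitPlane := by
    intro s hs
    left
    rw [Complex.add_re, Complex.one_re, Complex.re_ofReal_mul, Complex.re_mul_ofReal]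
    have := hs.1
    positivity
  have h3 : ∀ s ∈ Ioc (0 : ℝ) 1, ∫ ξ in Ioi (0 : ℝ), z * Complex.exp (-(s * z + B) * ξ) =
      1 * (z * (B⁻¹ : ℝ)) / (1 + (s : ℂ) * (z * (B⁻¹ : ℝ))) := by
    intro s hs
    have hre : 0 < (s * z + B : ℂ).re := by
      rw [Complex.add_re, Complex.re_ofReal_mul, Complex.ofReal_re]
      have := hs.1
      positivity
    have hne : (s * z + B : ℂ) ≠ 0 := fun h => by simp [h] at hre
    have hne2 : (B + s * z : ℂ) ≠ 0 := by rwa [add_comm]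
    rw [integral_const_mul, integral_exp_mul_complex_Ioi (by rw [Complex.neg_re]; linarith)]
    push_cast
    rw [mul_zero, Complex.exp_zero]
    field_simp
    ring
  rw [setIntegral_congr_fun measurableSet_Ioi h1, integral_integral_swap h2,
    setIntegral_congr_fun measurableSet_Ioc h3, ← intervalIntegral.integral_of_le zero_le_one,
    intervalIntegral.integral_eq_sub_of_hasDerivAt
      (f := fun s : ℝ => Complex.log (1 + s * (z * (B⁻¹ : ℝ))))]
  · simp
  · intro s hs
    rw [uIcc_of_le zero_le_one] at hs
    exact (((hasDerivAt_id s).ofReal_comp.mul_const _).const_add 1).clog_real (hslit s hs)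
  · refine ContinuousOn.intervalIntegrable ?_
    rw [uIcc_of_le zero_le_one]
    exact ContinuousOn.div (by fun_prop) (by fun_prop) fun s hs =>
      Complex.slitPlane_ne_zero (hslit s hs)

theorem integrableOn_one_sub_exp_div_mul_phi {z : ℂ} (hz : 0 ≤ z.re) :
    IntegrableOn (fun ξ : ℝ => (1 - Complex.exp (-z * (ξ : ℂ))) / (ξ : ℂ) * (phi ξ : ℂ))
      (Ioi 0) := by
  refine (integrableOn_exp_neg_inv_exp_one.const_mul ‖z‖).mono'
    (Measurable.aestronglyMeasurable (by fun_prop)) ?_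
  filter_upwards [ae_restrict_mem measurableSet_Ioi] with ξ hξ
  have hξ0 : 0 < ξ := hξ
  rw [norm_mul, Complex.norm_of_nonneg (phi_pos hξ0.le).le]
  exact mul_le_mul (norm_one_sub_exp_div_le hz hξ0) (phi_le hξ0.le) (phi_pos hξ0.le).le
    (norm_nonneg z)

/-- Insert the integral defining φ and swap; the double integrand is dominated by |z| e^{-ξ/e}. The
inner ξ-integral is the Frullani-type formula with B = b(v). -/
theorem integral_one_sub_exp_div_mul_phi {z : ℂ} (hz : 0 ≤ z.re) :
    ∫ ξ in Ioi (0 : ℝ), (1 - Complex.exp (-z * (ξ : ℂ))) / (ξ : ℂ) * (phi ξ : ℂ) =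
      logIntegral z := by
  have h1 : ∀ ξ : ℝ, (1 - Complex.exp (-z * (ξ : ℂ))) / (ξ : ℂ) * (phi ξ : ℂ) =
      (1 / Real.pi : ℝ) * ∫ v in Ioo 0 Real.pi,
        (1 - Complex.exp (-z * (ξ : ℂ))) / (ξ : ℂ) * (phiIntegrand ξ v : ℂ) := by
    intro ξ
    rw [integral_const_mul, integral_complex_ofReal, phi_eq, Complex.ofReal_mul]
    ring
  have h2 : Integrable (Function.uncurry fun (ξ v : ℝ) =>
      (1 - Complex.exp (-z * (ξ : ℂ))) / (ξ : ℂ) * (phiIntegrand ξ v : ℂ))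
      ((volume.restrict (Ioi 0)).prod (volume.restrict (Ioo 0 Real.pi))) := by
    refine integrable_prod_of_norm_le_exp measurableSet_Ioo (by simp) (C := ‖z‖)
      (c := (Real.exp 1)⁻¹) ?_ (by positivity) fun ξ hξ v hv => ?_
    · have hm := measurable_phiIntegrand.complex_ofReal
      exact Measurable.mul (f := fun p : ℝ × ℝ => (1 - Complex.exp (-z * (p.1 : ℂ))) / (p.1 : ℂ))
        (by fun_prop) hm
    · simp only [Function.uncurry]
      rw [norm_mul, Complex.norm_of_nonneg (phiIntegrand_pos ξ v).le]
      exact mul_le_mul (norm_one_sub_exp_div_le hz hξ) (phiIntegrand_le hξ.le hv)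
        (phiIntegrand_pos ξ v).le (norm_nonneg z)
  simp only [h1]
  rw [integral_const_mul, integral_integral_swap h2, logIntegral]
  congr 1
  exact setIntegral_congr_fun measurableSet_Ioo fun v hv =>
    integral_one_sub_exp_div_mul_exp hz (cutModulus_pos hv)

/-! ### The Lévy measure -/

theorem measurable_phi_div : Measurable fun ξ => ENNReal.ofReal (phi ξ / ξ) := by
  fun_prop

theorem toReal_density_smul {z : ℂ} {ξ : ℝ} (hξ : 0 < ξ) :
    (ENNReal.ofReal (phi ξ / ξ)).toReal • (1 - Complex.exp (-z * (ξ : ℂ))) =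
      (1 - Complex.exp (-z * (ξ : ℂ))) / (ξ : ℂ) * (phi ξ : ℂ) := by
  rw [ENNReal.toReal_ofReal (div_nonneg (phi_pos hξ.le).le hξ.le), Complex.real_smul]
  push_cast
  ring

theorem integrable_levyMeasure {z : ℂ} (hz : 0 ≤ z.re) :
    Integrable (fun ξ : ℝ => 1 - Complex.exp (-z * (ξ : ℂ))) levyMeasure := by
  rw [levyMeasure, integrable_withDensity_iff_integrable_smul' measurable_phi_div
    (Filter.Eventually.of_forall fun _ => ENNReal.ofReal_lt_top)]
  exact (integrableOn_one_sub_exp_div_mul_phi hz).congr_fun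
    (fun ξ hξ => (toReal_density_smul hξ).symm) measurableSet_Ioi

theorem integral_levyMeasure (z : ℂ) :
    ∫ ξ, (1 - Complex.exp (-z * (ξ : ℂ))) ∂levyMeasure =
      ∫ ξ in Ioi (0 : ℝ), (1 - Complex.exp (-z * (ξ : ℂ))) / (ξ : ℂ) * (phi ξ : ℂ) := by
  rw [levyMeasure, integral_withDensity_eq_integral_toReal_smul measurable_phi_div
    (Filter.Eventually.of_forall fun _ => ENNReal.ofReal_lt_top)]
  exact setIntegral_congr_fun measurableSet_Ioi fun ξ hξ => toReal_density_smul hξ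

/-- The factor ξ cancels the 1/ξ of the density, leaving φ(ξ)/(1+ξ) ≤ e^{-ξ/e}, which is integrable.
-/
theorem isLevyMeasure_levyMeasure : IsLevyMeasure levyMeasure := by
  constructor
  · refine withDensity_absolutelyContinuous _ _ ?_
    rw [Measure.restrict_apply measurableSet_Iic, Iic_inter_Ioi, Ioc_self, measure_empty]
  · rw [levyMeasure, lintegral_withDensity_eq_lintegral_mul _ measurable_phi_div (by fun_prop)]
    refine lt_of_le_of_lt (setLIntegral_mono (by fun_prop) fun ξ hξ => ?_)
      integrableOn_exp_neg_inv_exp_one.lintegral_lt_top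
    have hξ0 : 0 < ξ := hξ
    have hp := phi_pos hξ0.le
    rw [Pi.mul_apply, ← ENNReal.ofReal_mul (by positivity)]
    refine ENNReal.ofReal_le_ofReal (le_trans ?_ (phi_le hξ0.le))
    rw [div_mul_div_cancel₀ hξ0.ne']
    exact div_le_self hp.le (by linarith)

end Lambert

theorem mainTheorem10 :
    (∀ ξ : ℝ, 0 < ξ →
      IntervalIntegrable (Lambert.phiIntegrand ξ) volume 0 Real.pi ∧ 0 < Lambert.phi ξ) ∧
    (∀ z : ℂ, 0 ≤ z.re →
      IntegrableOn
        (fun ξ : ℝ => (1 - Complex.exp (-z * (ξ : ℂ))) / (ξ : ℂ) * (Lambert.phi ξ : ℂ))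
        (Ioi 0) volume ∧
      Lambert.lambertW z =
        ∫ ξ in Ioi (0 : ℝ),
          (1 - Complex.exp (-z * (ξ : ℂ))) / (ξ : ℂ) * (Lambert.phi ξ : ℂ)) ∧
    Lambert.IsLevyMeasure Lambert.levyMeasure ∧
    (∀ z : ℂ, 0 ≤ z.re →
      Integrable (fun ξ : ℝ => 1 - Complex.exp (-z * (ξ : ℂ))) Lambert.levyMeasure ∧
      Lambert.lambertW z =
        ∫ ξ, (1 - Complex.exp (-z * (ξ : ℂ))) ∂Lambert.levyMeasure) := by
  have hW : ∀ z : ℂ, 0 ≤ z.re → Lambert.lambertW z = ∫ ξ in Ioi (0 : ℝ),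
      (1 - Complex.exp (-z * (ξ : ℂ))) / (ξ : ℂ) * (Lambert.phi ξ : ℂ) := fun z hz => by
    rw [Lambert.lambertW_eq_logIntegral (Lambert.mem_branchCut_compl_of_re_nonneg hz),
      Lambert.integral_one_sub_exp_div_mul_phi hz]
  refine ⟨fun ξ hξ => ⟨Lambert.intervalIntegrable_phiIntegrand hξ.le, Lambert.phi_pos hξ.le⟩,
    fun z hz => ⟨Lambert.integrableOn_one_sub_exp_div_mul_phi hz, hW z hz⟩,
    Lambert.isLevyMeasure_levyMeasure, fun z hz => ⟨Lambert.integrable_levyMeasure hz, ?_⟩⟩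
  rw [hW z hz, Lambert.integral_levyMeasure]
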